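/- Let $\mathcal H\subset\mathbb R^k$ be nonempty and compact, let $\mathcal Z\subset\mathbb R^d$ be compact and convex, let $P$ be a Borel probability measure on $\mathbb R^d$ with $P(\mathcal Z)=1$, and let $Z_1,\dots,Z_n$ ($n\ge 1$) be i.i.d. with law $P$. Let $\|\cdot\|$ be the Euclidean norm, $\|A\|_1=\sum_{i,j}|A_{ij}|$ for a matrix $A$, $\mathsf{diam}(\mathcal Z)$ the Euclidean diameter of $\mathcal Z$, and $\pi_{\mathcal Z}$ the nearest-point projection onto $\mathcal Z$. Fix a depth $\ell$ and widths $w_0=k,w_1,\dots,w_\ell=d$. For $j=1,\dots,\ell$ let $\sigma_j:\mathbb R^{w_j}\to\mathbb R^{w_j}$ be $L_j$-Lipschitz with respect to $\|\cdot\|$ and satisfy $\|\sigma_j(x)\|\le B_j$ for all $x\in\mathbb R^{w_j}$ (it is not assumed that $\sigma_j(0)=0$), let $M_j>0$, and let $\mathcal A_j\subseteq\{A\in\mathbb R^{w_j\times w_{j-1}}:\|A\|_1\le M_j\}$. Put $B_0:=\sup_{h\in\mathcal H}\|h\|$. Let $\mathcal F_\ell$ be the class of all maps $$h\mapsto \pi_{\mathcal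 Z}\bigl(\sigma_\ell(A_\ell\,\sigma_{\ell-1}(A_{\ell-1}\cdots\sigma_1(A_1h)\cdots))\bigr),\qquad A_j\in\mathcal A_j,\ j=1,\dots,\ell,$$ and let $$\mathsf{gen}(\mathcal F_\ell):=\sup_{f\in\mathcal F_\ell}\Bigl|\mathbf E_P\min_{h\in\mathcal H}\|Z-f(h)\|^2-\frac1n\sum_{i=1}^n\min_{h\in\mathcal H}\|Z_i-f(h)\|^2\Bigr|.$$ Then for every $\delta\in(0,1)$, with probability at least $1-\delta$, $$\mathsf{gen}(\mathcal F_\ell)\le\frac{48\sqrt2\,\log n}{\sqrt n}\,\mathsf{diam}(\mathcal Z)\Bigl(\sum_{i=1}^\ell B_{i-1}\prod_{j=i}^\ell L_jM_j\Bigr)\sqrt{\sum_{i=1}^\ell\log(2w_{i-1}w_i+1)}+\frac{8\,\mathsf{diam}^2(\mathcal Z)}{\sqrt n}+\mathsf{diam}^2(\mathcal Z)\sqrt{\frac{2\log(2/\delta)}{n}}.$$ -/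

import Mathlib

open MeasureTheory ProbabilityTheory
open scoped NNReal ENNReal

noncomputable section

/-! ### Coding schemes and their generalization error -/

section Coding

variable {X E : Type*} [NormedAddCommGroup E]

/-- The minimal reconstruction error `e_f(z) = min_{h ∈ H} ‖z - f h‖ ^ 2`. -/
def minError (H : Set X) (f : X → E) (z : E) : ℝ :=
  ⨅ h : H, ‖z - f h‖ ^ 2

/-- The expected reconstruction error `R(P, f) = E_P [e_f(Z)]`. -/
def reconRisk [MeasurableSpace E] (H : Set X) (P : Measure E) (f : X → E) : ℝ :=
  ∫ z, minError H f z ∂P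

/-- The empirical distribution of the sample `z 0, …, z (n - 1)`. -/
def empiricalMeasure [MeasurableSpace E] {n : ℕ} (z : Fin n → E) : Measure E :=
  (n : ℝ≥0∞)⁻¹ • ∑ i, Measure.dirac (z i)

/-- The generalization error `sup_{f ∈ F} |R(P, f) - R(P_n, f)|` of the class `F`, where `P_n` is
the empirical distribution of the sample `z`. The supremum is taken in `[0, ∞]`. -/
def genError [MeasurableSpace E] {n : ℕ} (H : Set X) (P : Measure E) (F : Set (X → E))
    (z : Fin n → E) : ℝ≥0∞ :=
  ⨆ f ∈ F, ENNReal.ofReal |reconRisk H P f - reconRisk H (empiricalMeasure z) f|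

/-- The projection onto `S`: a point of `S` nearest to `ξ`. It exists when `S` is compact and
nonempty, and is unique when `S` is moreover a convex subset of a Euclidean space. -/
def projOnto (S : Set E) (ξ : E) : E :=
  Classical.epsilon fun z => z ∈ S ∧ ∀ z' ∈ S, ‖ξ - z‖ ≤ ‖ξ - z'‖

theorem projOnto_spec {S : Set E} (hS : IsCompact S) (hne : S.Nonempty) (ξ : E) :
    projOnto S ξ ∈ S ∧ ∀ z' ∈ S, ‖ξ - projOnto S ξ‖ ≤ ‖ξ - z'‖ := by
  have hc : ContinuousOn (fun z : E => ‖ξ - z‖) S := by fun_prop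
  obtain ⟨z, hz, hmin⟩ := hS.exists_isMinOn hne hc
  exact Classical.epsilon_spec
    (p := fun z => z ∈ S ∧ ∀ z' ∈ S, ‖ξ - z‖ ≤ ‖ξ - z'‖) ⟨z, hz, fun z' hz' => hmin hz'⟩

/-- The maximal norm `‖H‖_∞ = sup_{h ∈ H} ‖h‖` of the elements of `H`. -/
def supNorm (H : Set E) : ℝ := sSup (norm '' H)

/-- `inputBound H B i` bounds the norm of the input of layer `i`, the layers being numbered from
`0`: it is `‖H‖_∞` for the first layer and the bound `B (i - 1)` on the outputs of the preceding
activation for the later ones. -/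
def inputBound (H : Set E) (B : ℕ → ℝ) : ℕ → ℝ
  | 0 => supNorm H
  | i + 1 => B i

end Coding

/-! ### Fully connected nets

Layers are numbered from `0`: layer `j` has the weight matrix `A j`, of size `w (j + 1) × w j`, and
the activation `σ j`, so that it maps `ℝ^(w j)` to `ℝ^(w (j + 1))`. A net of depth `ℓ` consists of
the layers `0, …, ℓ - 1`; entries of the sequences at later indices play no role. -/

/-- The entrywise `ℓ₁` norm of a matrix. -/
def entrywiseL1 {p q : ℕ} (A : Matrix (Fin p) (Fin q) ℝ) : ℝ :=
  ∑ i, ∑ j, |A i j|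

/-- One fully connected layer, `ξ ↦ σ (A ξ)`. -/
def denseLayer {p q : ℕ} (σ : EuclideanSpace ℝ (Fin p) → EuclideanSpace ℝ (Fin p))
    (A : Matrix (Fin p) (Fin q) ℝ) (ξ : EuclideanSpace ℝ (Fin q)) : EuclideanSpace ℝ (Fin p) :=
  σ (WithLp.toLp 2 (A.mulVec (WithLp.ofLp ξ)))

/-- The fully connected net of depth `ℓ`. -/
def denseNet (w : ℕ → ℕ)
    (σ : ∀ j, EuclideanSpace ℝ (Fin (w (j + 1))) → EuclideanSpace ℝ (Fin (w (j + 1))))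
    (A : ∀ j, Matrix (Fin (w (j + 1))) (Fin (w j)) ℝ) :
    ∀ ℓ, EuclideanSpace ℝ (Fin (w 0)) → EuclideanSpace ℝ (Fin (w ℓ))
  | 0 => id
  | ℓ + 1 => fun h => denseLayer (σ ℓ) (A ℓ) (denseNet w σ A ℓ h)

/-- The class of reconstruction maps `π_S ∘ f(·; A)`, where `f(·; A)` is the net of depth `ℓ` with
weight matrices `A j ∈ 𝒜 j`. -/
def denseClass (w : ℕ → ℕ)
    (σ : ∀ j, EuclideanSpace ℝ (Fin (w (j + 1))) → EuclideanSpace ℝ (Fin (w (j + 1))))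
    (𝒜 : ∀ j, Set (Matrix (Fin (w (j + 1))) (Fin (w j)) ℝ)) (ℓ : ℕ)
    (S : Set (EuclideanSpace ℝ (Fin (w ℓ)))) :
    Set (EuclideanSpace ℝ (Fin (w 0)) → EuclideanSpace ℝ (Fin (w ℓ))) :=
  {f | ∃ A : ∀ j, Matrix (Fin (w (j + 1))) (Fin (w j)) ℝ,
    (∀ j < ℓ, A j ∈ 𝒜 j) ∧ f = fun h => projOnto S (denseNet w σ A ℓ h)}

end

/-! The supremum is controlled by Dudley chaining over the reconstruction errors, with covering
numbers from Maurey's sampling argument.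

Covers: with `D` the diameter and `Λ` the sum over layers in the bound, a relative Frobenius
perturbation `η` of every weight matrix moves the network by at most `η * Λ`
(`norm_denseNet_sub_le`), and the reconstruction error by at most `2 * D * η * Λ`, since projecting
is nonexpansive and squares of distances at most `D` are `2 * D`-Lipschitz. By Maurey, averages of
`k` of the `2pq + 1` points `0`, `± M E_ij` cover the entrywise `ℓ₁` ball to relative accuracy `1 /
√k`, with at most `(2pq + 1) ^ k` centers. Taking `k` of order `(D * Λ / ε) ^ 2` gives log-covering
numbers `V ^ 2 / ε ^ 2` (`exists_finset_denseErrorClass_cover`).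

Chaining: at this entropy rate the link width cancels the entropy, so every dyadic scale contributes
the same `2 * √2 * V`. Stopping after about `log₂ n` scales leaves a negligible remainder; this is
the source of `log n`. Each link is handled by Hoeffding and a union bound, with failure
probabilities summing to `δ`, so the result holds with high probability directly, without
symmetrization (`measure_compl_uniform_meanDeviation_le`). -/

/-! ### Uniform deviations of bounded functions by chaining -/

section Chaining

variable {Ω E : Type*} [MeasurableSpace Ω] [MeasurableSpace E]

/-- The difference between the mean of `g` under `P` and its average over the sample `z`. -/
noncomputable def meanDeviation {n : ℕ} (P : Measure E) (z : Fin n → E) (g : E → ℝ) : ℝ :=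
  ∫ x, g x ∂P - (n : ℝ)⁻¹ * ∑ i, g (z i)

theorem meanDeviation_sub {n : ℕ} {P : Measure E} (z : Fin n → E) {g h : E → ℝ}
    (hg : Integrable g P) (hh : Integrable h P) :
    meanDeviation P z (fun x => g x - h x) = meanDeviation P z g - meanDeviation P z h := by
  simp only [meanDeviation, integral_sub hg hh, Finset.sum_sub_distrib]
  ring

theorem abs_meanDeviation_le_of_abs_le {n : ℕ} (hn : 0 < n) {P : Measure E}
    [IsProbabilityMeasure P] {S : Set E} (hP : ∀ᵐ x ∂P, x ∈ S) {z : Fin n → E}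
    (hz : ∀ i, z i ∈ S) {g : E → ℝ} {c : ℝ} (hg : ∀ x ∈ S, |g x| ≤ c) :
    |meanDeviation P z g| ≤ 2 * c := by
  have h1 : |∫ x, g x ∂P| ≤ c := by
    have := norm_integral_le_of_norm_le_const (μ := P) (f := g) (C := c)
      (hP.mono fun x hx => hg x hx)
    simpa using this
  have hn' : (0 : ℝ) < n := by exact_mod_cast hn
  have h2 : |(n : ℝ)⁻¹ * ∑ i, g (z i)| ≤ c := by
    rw [abs_mul, abs_of_pos (inv_pos.2 hn'), inv_mul_le_iff₀ hn']
    calc |∑ i, g (z i)| ≤ ∑ i, |g (z i)| := Finset.abs_sum_le_sum_abs _ _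
      _ ≤ ∑ _i : Fin n, c := Finset.sum_le_sum fun i _ => hg _ (hz i)
      _ = n * c := by simp
  calc |meanDeviation P z g| ≤ |∫ x, g x ∂P| + |(n : ℝ)⁻¹ * ∑ i, g (z i)| := abs_sub _ _
    _ ≤ 2 * c := by linarith

/-- Both means lie in `[0, c]`, which saves the factor `2` of the symmetric version; it settles the
degenerate cases of the chaining theorem. -/
theorem abs_meanDeviation_le_of_mem_Icc {n : ℕ} (hn : 0 < n) {P : Measure E}
    [IsProbabilityMeasure P] {S : Set E} (hP : ∀ᵐ x ∂P, x ∈ S) {z : Fin n → E}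
    (hz : ∀ i, z i ∈ S) {g : E → ℝ} {c : ℝ} (hg : ∀ x ∈ S, g x ∈ Set.Icc 0 c)
    (hgP : Integrable g P) :
    |meanDeviation P z g| ≤ c := by
  have hn' : (0 : ℝ) < n := by exact_mod_cast hn
  have h1 : 0 ≤ ∫ x, g x ∂P := integral_nonneg_of_ae (hP.mono fun x hx => (hg x hx).1)
  have h2 : ∫ x, g x ∂P ≤ c := by
    have := integral_mono_ae hgP (integrable_const c) (hP.mono fun x hx => (hg x hx).2)
    simpa using this
  have h3 : 0 ≤ (n : ℝ)⁻¹ * ∑ i, g (z i) :=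
    mul_nonneg (by positivity) (Finset.sum_nonneg fun i _ => (hg _ (hz i)).1)
  have h4 : (n : ℝ)⁻¹ * ∑ i, g (z i) ≤ c := by
    rw [inv_mul_le_iff₀ hn']
    calc ∑ i, g (z i) ≤ ∑ _i : Fin n, c := Finset.sum_le_sum fun i _ => (hg _ (hz i)).2
      _ = n * c := by simp
  rw [meanDeviation, abs_le]
  constructor <;> linarith

/-- Hoeffding's inequality, two-sided, for the average of a bounded function over an i.i.d.
sample. -/
theorem measure_meanDeviation_gt_le {μ : Measure Ω} [IsProbabilityMeasure μ] {P : Measure E}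
    [IsProbabilityMeasure P] {n : ℕ} (hn : 0 < n) {Z : Fin n → Ω → E}
    (hZ : ∀ i, Measurable (Z i)) (hindep : iIndepFun Z μ) (hlaw : ∀ i, μ.map (Z i) = P)
    {g : E → ℝ} (hg : Measurable g) {a b : ℝ} (hab : a < b) (hgab : ∀ᵐ x ∂P, g x ∈ Set.Icc a b)
    {t : ℝ} (ht : 0 ≤ t) :
    μ {ω | (b - a) * √(t / (2 * n)) < |meanDeviation P (fun i => Z i ω) g|} ≤
      ENNReal.ofReal (2 * Real.exp (-t)) := by
  have hn' : (0 : ℝ) < n := by exact_mod_cast hn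
  have hba : 0 < b - a := sub_pos.2 hab
  set ε : ℝ := n * ((b - a) * √(t / (2 * n))) with hε
  have hε0 : 0 ≤ ε := by positivity
  set c : ℝ≥0 := (‖b - a‖₊ / 2) ^ 2 with hc
  have hcval : (c : ℝ) = ((b - a) / 2) ^ 2 := by
    simp [hc, abs_of_pos hba]
  have hsub : ∀ i, HasSubgaussianMGF (fun ω => g (Z i ω) - ∫ x, g x ∂P) c μ := by
    intro i
    have hmean : ∫ ω, g (Z i ω) ∂μ = ∫ x, g x ∂P := by
      rw [← hlaw i, integral_map (hZ i).aemeasurable hg.aestronglyMeasurable]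
    have := hasSubgaussianMGF_of_mem_Icc (μ := μ) (X := fun ω => g (Z i ω)) (a := a) (b := b)
      (hg.comp (hZ i)).aemeasurable (by
        have h := hgab
        rw [← hlaw i] at h
        exact ae_of_ae_map (hZ i).aemeasurable h)
    rwa [hmean] at this
  have hind : iIndepFun (fun i ω => g (Z i ω) - ∫ x, g x ∂P) μ :=
    hindep.comp (fun _ x => g x - ∫ x, g x ∂P) (fun _ => hg.sub_const _)
  have hind' : iIndepFun (fun i ω => -(g (Z i ω) - ∫ x, g x ∂P)) μ :=
    hindep.comp (fun _ x => -(g x - ∫ x, g x ∂P)) (fun _ => (hg.sub_const _).neg)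
  have hexp : -ε ^ 2 / (2 * ∑ _i : Fin n, (c : ℝ)) = -t := by
    have hs : √(t / (2 * n)) ^ 2 = t / (2 * n) := Real.sq_sqrt (by positivity)
    rw [Finset.sum_const, Finset.card_univ, Fintype.card_fin, nsmul_eq_mul, hcval, hε, mul_pow,
      mul_pow, hs]
    field_simp
  have h1 := HasSubgaussianMGF.measure_sum_ge_le_of_iIndepFun hind (c := fun _ => c)
    (s := Finset.univ) (fun i _ => hsub i) hε0
  have h2 := HasSubgaussianMGF.measure_sum_ge_le_of_iIndepFun hind' (c := fun _ => c)
    (s := Finset.univ) (fun i _ => (hsub i).neg) hε0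
  push_cast at h1 h2
  rw [hexp] at h1 h2
  have hsum : ∀ ω, ∑ i, (g (Z i ω) - ∫ x, g x ∂P)
      = -(n * meanDeviation P (fun i => Z i ω) g) := by
    intro ω
    rw [meanDeviation, Finset.sum_sub_distrib]
    simp only [Finset.sum_const, Finset.card_univ, Fintype.card_fin, nsmul_eq_mul]
    field_simp
    ring
  have hincl : {ω | (b - a) * √(t / (2 * n)) < |meanDeviation P (fun i => Z i ω) g|} ⊆
      {ω | ε ≤ ∑ i, (g (Z i ω) - ∫ x, g x ∂P)} ∪ {ω | ε ≤ ∑ i, -(g (Z i ω) - ∫ x, g x ∂P)} := by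
    intro ω hω
    simp only [Set.mem_ofPred_eq, Set.mem_union, Finset.sum_neg_distrib, hsum, neg_neg] at hω ⊢
    rcases lt_abs.1 hω with h | h
    · right
      exact mul_le_mul_of_nonneg_left h.le hn'.le
    · left
      have := mul_le_mul_of_nonneg_left h.le hn'.le
      rw [hε]
      linarith
  have htot : μ.real {ω | (b - a) * √(t / (2 * n)) < |meanDeviation P (fun i => Z i ω) g|} ≤
      2 * Real.exp (-t) :=
    calc _ ≤ _ := measureReal_mono hincl
      _ ≤ _ := measureReal_union_le _ _
      _ ≤ _ := by linarith
  rw [← ofReal_measureReal]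
  exact ENNReal.ofReal_le_ofReal htot

/-- A union bound over finitely many functions. -/
theorem measure_exists_meanDeviation_gt_le {μ : Measure Ω} [IsProbabilityMeasure μ]
    {P : Measure E} [IsProbabilityMeasure P] {n : ℕ} (hn : 0 < n) {Z : Fin n → Ω → E}
    (hZ : ∀ i, Measurable (Z i)) (hindep : iIndepFun Z μ) (hlaw : ∀ i, μ.map (Z i) = P)
    {ι : Type*} (C : Finset ι) {g : ι → E → ℝ} (hg : ∀ c ∈ C, Measurable (g c)) {a b : ℝ}
    (hab : a < b) (hgab : ∀ c ∈ C, ∀ᵐ x ∂P, g c x ∈ Set.Icc a b) {s η : ℝ} (hs : 0 ≤ s)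
    (hcard : (C.card : ℝ) ≤ Real.exp s) (hη : 0 < η) (hη1 : η ≤ 1) :
    μ {ω | ∃ c ∈ C, (b - a) * √((s + Real.log (2 / η)) / (2 * n)) <
      |meanDeviation P (fun i => Z i ω) (g c)|} ≤ ENNReal.ofReal η := by
  have hlog : 0 ≤ Real.log (2 / η) := Real.log_nonneg (by rw [le_div_iff₀ hη]; linarith)
  have hset : {ω | ∃ c ∈ C, (b - a) * √((s + Real.log (2 / η)) / (2 * n)) <
      |meanDeviation P (fun i => Z i ω) (g c)|} = ⋃ c ∈ C,
      {ω | (b - a) * √((s + Real.log (2 / η)) / (2 * n)) <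
        |meanDeviation P (fun i => Z i ω) (g c)|} := by
    ext ω; simp
  -- Hoeffding at level `s + log (2 / η)`: the factor `exp (-s)` pays for the number of functions,
  -- and `η` is left.
  have hval : 2 * Real.exp (-(s + Real.log (2 / η))) = Real.exp (-s) * η := by
    rw [neg_add, Real.exp_add, Real.exp_neg (Real.log _), Real.exp_log (by positivity)]
    field_simp
  rw [hset]
  calc _ ≤ ∑ c ∈ C, μ {ω | (b - a) * √((s + Real.log (2 / η)) / (2 * n)) <
        |meanDeviation P (fun i => Z i ω) (g c)|} := measure_biUnion_finset_le _ _
    _ ≤ ∑ _c ∈ C, ENNReal.ofReal (Real.exp (-s) * η) := Finset.sum_le_sum fun c hc => by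
        rw [← hval]
        exact measure_meanDeviation_gt_le hn hZ hindep hlaw (hg c hc) hab (hgab c hc)
          (by positivity)
    _ = ENNReal.ofReal (C.card * (Real.exp (-s) * η)) := by
        rw [Finset.sum_const, nsmul_eq_mul, ENNReal.ofReal_mul (Nat.cast_nonneg _),
          ENNReal.ofReal_natCast]
    _ ≤ ENNReal.ofReal η := ENNReal.ofReal_le_ofReal <| by
        calc C.card * (Real.exp (-s) * η) ≤ Real.exp s * (Real.exp (-s) * η) := by gcongr
          _ = η := by rw [← mul_assoc, ← Real.exp_add]; simp

/-- The partial sums of the chaining bound satisfy their recursion. -/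
theorem chaining_bound_step {K V q : ℝ} (t : ℕ) :
    2 * √2 * V * (t + 1) + √2 / 2 * K * (q + 1 + q * (1 - (1 / 2) ^ t) + 3 - (t + 3) * (1 / 2) ^ t)
      + 2 * √2 * (V + K / 4 * (1 / 2) ^ (t + 1) * (q + (t + 2)))
    = 2 * √2 * V * ((t + 1 : ℕ) + 1) + √2 / 2 * K * (q + 1 + q * (1 - (1 / 2) ^ (t + 1)) + 3
      - ((t + 1 : ℕ) + 3) * (1 / 2) ^ (t + 1)) := by
  push_cast
  ring

/-- Subadditivity of the square root separates entropy, confidence and the cost of the union over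
scales; the last is `√((t + 1) * log 2) ≤ t + 1`, summable against the widths `2 ^ (-t)`. -/
theorem sqrt_entropy_add_log_le {V ε δ : ℝ} (hV : 0 ≤ V) (hε : 0 < ε) (hδ : 0 < δ) (hδ1 : δ < 1)
    (t : ℕ) :
    √(V ^ 2 / ε ^ 2 + Real.log (2 / (δ / 2 / 2 ^ t))) ≤
      V / ε + (√(Real.log (2 / δ)) + (t + 1)) := by
  have hl : 0 ≤ Real.log (2 / δ) := Real.log_nonneg (by rw [le_div_iff₀ hδ]; linarith)
  have h2 : Real.log (2 / (δ / 2 / 2 ^ t)) = Real.log (2 / δ) + (t + 1) * Real.log 2 := by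
    have : 2 / (δ / 2 / 2 ^ t) = 2 / δ * 2 ^ (t + 1) := by field_simp; ring
    rw [this, Real.log_mul (by positivity) (by positivity), Real.log_pow]
    push_cast; ring
  have hlog2 : Real.log 2 ≤ 1 := by
    have := Real.log_two_lt_d9; linarith
  rw [h2]
  refine Real.sqrt_le_iff.2 ⟨by positivity, ?_⟩
  have hq := Real.sq_sqrt hl
  have hq0 := Real.sqrt_nonneg (Real.log (2 / δ))
  set q := √(Real.log (2 / δ))
  have hx : (0 : ℝ) ≤ V / ε := by positivity
  have ht : (0 : ℝ) ≤ t := Nat.cast_nonneg t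
  have e1 : V ^ 2 / ε ^ 2 = (V / ε) ^ 2 := by rw [div_pow]
  have e2 : ((t : ℝ) + 1) * Real.log 2 ≤ (t + 1) ^ 2 := by nlinarith
  have e3 : 0 ≤ V / ε * (q + (t + 1)) := by positivity
  have e4 : 0 ≤ q * ((t : ℝ) + 1) := by positivity
  rw [e1, ← hq]
  nlinarith

/-- The final numerical comparison in the chaining bound, at the level `Nat.log 2 n + 1`. -/
theorem chaining_bound_final {K V q : ℝ} (hK : 0 ≤ K) (hV : 0 ≤ V) (hq : 0 ≤ q) {n : ℕ}
    (hn : 2 ≤ n) :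
    1 / √n * (2 * √2 * V * ((Nat.log 2 n + 1 : ℕ) + 1) + √2 / 2 * K *
      (q + 1 + q * (1 - (1 / 2) ^ (Nat.log 2 n + 1)) + 3
        - ((Nat.log 2 n + 1 : ℕ) + 3) * (1 / 2) ^ (Nat.log 2 n + 1)))
      + 2 * (K / 4 * (1 / 2) ^ (Nat.log 2 n + 1))
    ≤ 24 * V * Real.log n / √n + 8 * K / √n + K * (√2 * q / √n) := by
  have hn1 : (1 : ℝ) ≤ n := by exact_mod_cast (by omega : 1 ≤ n)
  have hn0 : (0 : ℝ) < n := by linarith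
  set T := Nat.log 2 n + 1 with hT
  have hsn : 0 < √(n : ℝ) := Real.sqrt_pos.2 hn0
  have hsq : √(n : ℝ) ^ 2 = n := Real.sq_sqrt hn0.le
  have hs1 : 1 ≤ √(n : ℝ) := Real.one_le_sqrt.2 hn1
  have hs2 : √(2 : ℝ) ^ 2 = 2 := Real.sq_sqrt (by norm_num)
  have hs2' : √(2 : ℝ) ≤ 3 / 2 := Real.sqrt_le_iff.2 (by norm_num)
  have hs20 : 0 ≤ √(2 : ℝ) := Real.sqrt_nonneg _
  have hlog2 : (0.69 : ℝ) ≤ Real.log 2 := by have := Real.log_two_gt_d9; linarith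
  have hlogn : Real.log 2 ≤ Real.log n :=
    Real.log_le_log (by norm_num) (by exact_mod_cast hn)
  have hTlog : ((Nat.log 2 n : ℕ) : ℝ) * Real.log 2 ≤ Real.log n := by
    rw [← Real.log_pow]
    exact Real.log_le_log (by positivity) (by exact_mod_cast Nat.pow_log_le_self 2 (by omega))
  -- Here `T + 1 = ⌊log₂ n⌋ + 2`, and `n ≥ 2` lets `log n` absorb the additive constant.
  have hT8 : ((T : ℝ) + 1) ≤ 8 * Real.log n := by
    have h0 : (0 : ℝ) ≤ (Nat.log 2 n : ℕ) := Nat.cast_nonneg _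
    rw [hT]; push_cast
    nlinarith
  have hp0 : (0 : ℝ) ≤ (1 / 2) ^ T := by positivity
  have hpn : (1 / 2 : ℝ) ^ T ≤ 1 / √n := by
    rw [one_div_pow]
    refine one_div_le_one_div_of_le hsn ?_
    have h1 : (n : ℝ) ≤ 2 ^ T := by
      exact_mod_cast (Nat.lt_pow_succ_log_self (by norm_num) n).le
    nlinarith
  have hV8 : 2 * √2 * V * ((T : ℝ) + 1) ≤ 24 * V * Real.log n := by
    have h1 : V * ((T : ℝ) + 1) ≤ V * (8 * Real.log n) := mul_le_mul_of_nonneg_left hT8 hV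
    have h2 : 0 ≤ V * ((T : ℝ) + 1) := by positivity
    nlinarith
  have hmid : √2 / 2 * K * (q + 1 + q * (1 - (1 / 2) ^ T) + 3 - ((T : ℝ) + 3) * (1 / 2) ^ T)
      ≤ √2 / 2 * K * (2 * q + 4) := by
    refine mul_le_mul_of_nonneg_left ?_ (by positivity)
    have h1 : 0 ≤ q * (1 / 2) ^ T := by positivity
    have h2 : 0 ≤ ((T : ℝ) + 3) * (1 / 2) ^ T := by positivity
    nlinarith
  have hlast : 2 * (K / 4 * (1 / 2) ^ T) ≤ 1 / √n * K := by nlinarith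
  have hK2 : √2 * K ≤ 3 / 2 * K := mul_le_mul_of_nonneg_right hs2' hK
  calc _ ≤ 1 / √n * (24 * V * Real.log n + √2 / 2 * K * (2 * q + 4)) + 1 / √n * K := by gcongr
    _ = 1 / √n * (24 * V * Real.log n + √2 * K * q + (2 * (√2 * K) + K)) := by ring
    _ ≤ 1 / √n * (24 * V * Real.log n + √2 * K * q + 8 * K) := by gcongr; linarith
    _ = _ := by ring

end Chaining

/-! ### Assembling the chains -/

section Chaining

variable {Ω E : Type*} [MeasurableSpace Ω] [MeasurableSpace E]

/-- The deterministic part of chaining: bounds on the deviations of the links of the chains give a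
bound on the deviations of all members of the class. -/
theorem abs_meanDeviation_le_of_links {n : ℕ} (hn : 0 < n) {P : Measure E}
    [IsProbabilityMeasure P] {S : Set E} (hP : ∀ᵐ x ∂P, x ∈ S) {z : Fin n → E}
    (hz : ∀ i, z i ∈ S) {G : Set (E → ℝ)} (hGint : ∀ g ∈ G, Integrable g P)
    {K V q : ℝ} {C : ℕ → Finset (E → ℝ)} (hCG : ∀ t, ↑(C t) ⊆ G)
    {p : ℕ → (E → ℝ) → E → ℝ} (hpC : ∀ t, ∀ g ∈ G, p t g ∈ C t)
    (hpd : ∀ t, ∀ g ∈ G, ∀ x ∈ S, |g x - p t g x| ≤ K / 4 * (1 / 2) ^ t)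
    (h0 : ∀ c ∈ C 0, √n * |meanDeviation P z c| ≤ 2 * √2 * V + √2 / 2 * K * (q + 1))
    (hstep : ∀ t, ∀ c ∈ C (t + 1), √n * |meanDeviation P z (fun x => c x - p t c x)| ≤
      2 * √2 * (V + K / 4 * (1 / 2) ^ (t + 1) * (q + (t + 2))))
    (t : ℕ) {g : E → ℝ} (hg : g ∈ G) :
    |meanDeviation P z g| ≤ 1 / √n * (2 * √2 * V * (t + 1) + √2 / 2 * K *
      (q + 1 + q * (1 - (1 / 2) ^ t) + 3 - (t + 3) * (1 / 2) ^ t))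
      + 2 * (K / 4 * (1 / 2) ^ t) := by
  have hsn : 0 < √(n : ℝ) := Real.sqrt_pos.2 (by exact_mod_cast hn)
  have key : ∀ t : ℕ, ∀ c ∈ C t, √n * |meanDeviation P z c| ≤ 2 * √2 * V * (t + 1) +
      √2 / 2 * K * (q + 1 + q * (1 - (1 / 2) ^ t) + 3 - (t + 3) * (1 / 2) ^ t) := by
    intro t
    induction t with
    | zero => intro c hc; simpa using h0 c hc
    | succ t ih =>
      intro c hc
      have hcG : c ∈ G := hCG _ hc
      have hp := hpC t c hcG
      rw [← chaining_bound_step]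
      have hdecomp : meanDeviation P z c =
          meanDeviation P z (p t c) + meanDeviation P z (fun x => c x - p t c x) := by
        rw [meanDeviation_sub z (hGint _ hcG) (hGint _ (hCG _ hp))]; ring
      rw [hdecomp]
      calc _ ≤ √n * (|meanDeviation P z (p t c)| +
            |meanDeviation P z (fun x => c x - p t c x)|) := by gcongr; exact abs_add_le _ _
        _ ≤ _ := by rw [mul_add]; exact add_le_add (ih _ hp) (hstep t c hc)
  have hp := hpC t g hg
  have hdecomp : meanDeviation P z g =
      meanDeviation P z (p t g) + meanDeviation P z (fun x => g x - p t g x) := by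
    rw [meanDeviation_sub z (hGint _ hg) (hGint _ (hCG _ hp))]; ring
  rw [hdecomp]
  refine (abs_add_le _ _).trans (add_le_add ?_ ?_)
  · rw [one_div, ← div_eq_inv_mul, le_div_iff₀' hsn]
    exact key t _ hp
  · exact abs_meanDeviation_le_of_abs_le hn hP hz (hpd t g hg)

/-- Puts a Hoeffding bound for a function of range `r` into the normalization in which the links are
summed. -/
theorem sqrt_mul_width_le {n : ℕ} (hn : 0 < n) {y r b A : ℝ} (hr : 0 ≤ r)
    (hy : √y ≤ b) (hA : A ≤ r * √(y / (2 * n))) :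
    √n * A ≤ √2 / 2 * (r * b) := by
  have hsn : 0 < √(n : ℝ) := Real.sqrt_pos.2 (by exact_mod_cast hn)
  have hs2 : √(2 : ℝ) ^ 2 = 2 := Real.sq_sqrt (by norm_num)
  have hs20 : 0 < √(2 : ℝ) := Real.sqrt_pos.2 (by norm_num)
  have h : √(y / (2 * n)) = √2 / 2 * √y / √n := by
    rw [Real.sqrt_div' _ (by positivity), Real.sqrt_mul (by norm_num)]
    field_simp
    rw [hs2]
  calc √n * A ≤ √n * (r * √(y / (2 * n))) := by gcongr
    _ = √2 / 2 * (r * √y) := by rw [h]; field_simp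
    _ ≤ _ := by gcongr

/-- A uniform law of large numbers for a class of `[0, K]`-valued functions whose covering numbers
in the uniform distance grow at most like `exp (V ^ 2 / ε ^ 2)`. -/
theorem measure_compl_uniform_meanDeviation_le {μ : Measure Ω} [IsProbabilityMeasure μ]
    {P : Measure E} [IsProbabilityMeasure P] {S : Set E} (hP : ∀ᵐ x ∂P, x ∈ S)
    {n : ℕ} (hn : 0 < n) {Z : Fin n → Ω → E}
    (hZ : ∀ i, Measurable (Z i)) (hindep : iIndepFun Z μ) (hlaw : ∀ i, μ.map (Z i) = P)
    {G : Set (E → ℝ)} (hGm : ∀ g ∈ G, Measurable g) {K V : ℝ} (hK : 0 ≤ K) (hV : 0 ≤ V)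
    (hGK : ∀ g ∈ G, ∀ x ∈ S, g x ∈ Set.Icc 0 K)
    (hcov : ∀ ε > 0, ∃ C : Finset (E → ℝ), ↑C ⊆ G ∧ (C.card : ℝ) ≤ Real.exp (V ^ 2 / ε ^ 2) ∧
      ∀ g ∈ G, ∃ c ∈ C, ∀ x ∈ S, |g x - c x| ≤ ε)
    {δ : ℝ} (hδ₀ : 0 < δ) (hδ₁ : δ < 1) :
    μ {ω | ∀ g ∈ G, |meanDeviation P (fun i => Z i ω) g| ≤
      24 * V * Real.log n / √n + 8 * K / √n + K * √(2 * Real.log (2 / δ) / n)}ᶜ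
      ≤ ENNReal.ofReal δ := by
  have hn0 : (0 : ℝ) < n := by exact_mod_cast hn
  have hsn : 0 < √(n : ℝ) := Real.sqrt_pos.2 hn0
  have hlogn : 0 ≤ Real.log n := Real.log_natCast_nonneg n
  have hZS : ∀ᵐ ω ∂μ, ∀ i, Z i ω ∈ S := by
    refine ae_all_iff.2 fun i => ae_of_ae_map (hZ i).aemeasurable ?_
    rw [hlaw i]; exact hP
  have hGint : ∀ g ∈ G, Integrable g P := fun g hg =>
    Integrable.of_mem_Icc 0 K (hGm g hg).aemeasurable (hP.mono fun x hx => hGK g hg x hx)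
  -- For `n = 1` the `log n` term vanishes and cannot absorb the chain; for `K = 0` the scales
  -- degenerate. In both cases `8 * K / √n` already dominates.
  by_cases htriv : n < 2 ∨ K = 0
  · have hz : μ {ω | ∀ i, Z i ω ∈ S}ᶜ = 0 := hZS
    refine (measure_mono_null (Set.compl_subset_compl.2 fun ω hω g hg => ?_) hz).le.trans zero_le
    refine (abs_meanDeviation_le_of_mem_Icc hn hP hω (hGK g hg) (hGint g hg)).trans ?_
    have h1 : 0 ≤ 24 * V * Real.log n / √n := by positivity
    have h2 : 0 ≤ K * √(2 * Real.log (2 / δ) / n) := by positivity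
    have h3 : K ≤ 8 * K / √n := by
      rcases htriv with h | h
      · have : n = 1 := by omega
        subst this; simp; linarith
      · simp [h]
    linarith
  obtain ⟨hn2, hK0⟩ := not_or.1 htriv
  have hKpos : 0 < K := lt_of_le_of_ne hK (Ne.symm hK0)
  -- The initial radius `K / 4` makes the entropy cost of the root equal to that of each link, `2 *
  -- √2 * V`.
  set ε : ℕ → ℝ := fun t => K / 4 * (1 / 2) ^ t with hεdef
  have hε : ∀ t, 0 < ε t := fun t => by positivity
  choose C hCG hcard hnear using fun t => hcov (ε t) (hε t)
  choose! p hpC hpd using hnear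
  set η : ℕ → ℝ := fun t => δ / 2 / 2 ^ t with hηdef
  have hη0 : ∀ t, 0 < η t := fun t => by positivity
  have hη1 : ∀ t, η t ≤ 1 := fun t => by
    have : (1 : ℝ) ≤ 2 ^ t := one_le_pow₀ (by norm_num)
    rw [hηdef]
    simp only
    rw [div_le_one (by positivity)]
    linarith
  set y : ℕ → ℝ := fun t => V ^ 2 / ε t ^ 2 + Real.log (2 / η t) with hydef
  -- A link is determined by its finer endpoint `c`, so the union at level `t + 1` runs over `C (t +
  -- 1)` only, not over pairs. Centers lie in `G`, hence have parents themselves.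
  set bad : ℕ → Set Ω := fun t => Nat.casesOn t
    {ω | ∃ c ∈ C 0, (K - 0) * √(y 0 / (2 * n)) < |meanDeviation P (fun i => Z i ω) c|}
    (fun t => {ω | ∃ c ∈ C (t + 1), (ε t - -ε t) * √(y (t + 1) / (2 * n)) <
      |meanDeviation P (fun i => Z i ω) (fun x => c x - p t c x)|}) with hbad
  have hbadle : ∀ t, μ (bad t) ≤ ENNReal.ofReal (η t) := by
    intro t
    cases t with
    | zero =>
      exact measure_exists_meanDeviation_gt_le (g := fun c => c) hn hZ hindep hlaw (C 0)
        (fun c hc => hGm c (hCG 0 hc)) hKpos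
        (fun c hc => hP.mono fun x hx => hGK c (hCG 0 hc) x hx) (by positivity) (hcard 0)
        (hη0 0) (hη1 0)
    | succ t =>
      refine measure_exists_meanDeviation_gt_le (g := fun c x => c x - p t c x) hn hZ hindep hlaw
        (C (t + 1)) (fun c hc => ?_) (by linarith [hε t]) (fun c hc => ?_) (by positivity)
        (hcard (t + 1)) (hη0 _) (hη1 _)
      · have hcG := hCG _ hc
        exact (hGm c hcG).sub (hGm _ (hCG t (hpC t c hcG)))
      · exact hP.mono fun x hx => abs_le.1 (hpd t c (hCG _ hc) x hx)
  have hsum : μ (⋃ t, bad t) ≤ ENNReal.ofReal δ := by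
    calc μ (⋃ t, bad t) ≤ ∑' t, μ (bad t) := measure_iUnion_le _
      _ ≤ ∑' t, ENNReal.ofReal (η t) := ENNReal.tsum_le_tsum hbadle
      _ = ENNReal.ofReal (∑' t, η t) :=
        (ENNReal.ofReal_tsum_of_nonneg (fun t => (hη0 t).le) (summable_geometric_two' δ)).symm
      _ = ENNReal.ofReal δ := by rw [hηdef, tsum_geometric_two']
  have hnull : μ ({ω | ∀ i, Z i ω ∈ S}ᶜ ∪ ⋃ t, bad t) ≤ ENNReal.ofReal δ := by
    refine (measure_union_le _ _).trans ?_
    have hz : μ {ω | ∀ i, Z i ω ∈ S}ᶜ = 0 := hZS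
    rw [hz, zero_add]; exact hsum
  refine (measure_mono ?_).trans hnull
  rw [Set.compl_subset_comm, Set.compl_union, compl_compl, Set.compl_iUnion]
  rintro ω ⟨hω, hgood⟩ g hg
  rw [Set.mem_iInter] at hgood
  set q := √(Real.log (2 / δ)) with hq
  have hy : ∀ t : ℕ, √(y t) ≤ V / ε t + (q + (t + 1)) := fun t =>
    sqrt_entropy_add_log_le hV (hε t) hδ₀ hδ₁ t
  have hfin := chaining_bound_final hK hV (Real.sqrt_nonneg (Real.log (2 / δ)))
    (n := n) (by omega)
  have hrw : √(2 * Real.log (2 / δ) / n) = √2 * q / √n := by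
    rw [Real.sqrt_div' _ (by positivity), Real.sqrt_mul (by norm_num)]
  rw [hrw]
  refine le_trans ?_ hfin
  refine abs_meanDeviation_le_of_links hn hP hω hGint hCG hpC hpd ?_ ?_ _ hg
  · intro c hc
    have hA : |meanDeviation P (fun i => Z i ω) c| ≤ (K - 0) * √(y 0 / (2 * n)) := by
      by_contra hcon
      exact hgood 0 ⟨c, hc, not_le.1 hcon⟩
    refine (sqrt_mul_width_le hn (by linarith) (hy 0) hA).trans (le_of_eq ?_)
    simp only [hεdef]
    push_cast
    field_simp
    ring
  · intro t c hc
    have hA : |meanDeviation P (fun i => Z i ω) (fun x => c x - p t c x)| ≤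
        (ε t - -ε t) * √(y (t + 1) / (2 * n)) := by
      by_contra hcon
      exact hgood (t + 1) ⟨c, hc, not_le.1 hcon⟩
    refine (sqrt_mul_width_le hn (by linarith [hε t]) (hy (t + 1)) hA).trans (le_of_eq ?_)
    have h2 : ε t = 2 * ε (t + 1) := by simp only [hεdef]; ring
    have h3 : ε (t + 1) ≠ 0 := (hε (t + 1)).ne'
    change _ = 2 * √2 * (V + ε (t + 1) * (q + (t + 2)))
    rw [h2]
    push_cast
    field_simp
    ring

end Chaining

/-! ### Approximation in the convex hull and covers of the entrywise `ℓ₁` ball -/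

section Maurey

variable {F J : Type*} [NormedAddCommGroup F] [InnerProductSpace ℝ F] [Fintype J]

/-- Averaging over `j` with weights `p` kills the cross term and leaves `‖s‖ ^ 2` plus a variance at
most `M ^ 2`, so some `j` does no worse than the average. This is the greedy step of Maurey's
argument. -/
theorem exists_norm_add_sub_sq_le {v : J → F} {M : ℝ} (hv : ∀ j, ‖v j‖ ≤ M)
    {p : J → ℝ} (hp : ∀ j, 0 ≤ p j) (hp1 : ∑ j, p j = 1) (s : F) :
    ∃ j, ‖s + (v j - ∑ i, p i • v i)‖ ^ 2 ≤ ‖s‖ ^ 2 + M ^ 2 := by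
  set a := ∑ i, p i • v i with ha
  by_contra! hcon
  have hexp : ∀ j, ‖s + (v j - a)‖ ^ 2 =
      ‖s‖ ^ 2 + 2 * inner ℝ (s - a) (v j) - 2 * inner ℝ s a + ‖v j‖ ^ 2 + ‖a‖ ^ 2 := by
    intro j
    rw [norm_add_sq_real, norm_sub_sq_real, inner_sub_right, inner_sub_left,
      real_inner_comm a (v j)]
    ring
  have hinner : ∑ j, p j * inner ℝ (s - a) (v j) = inner ℝ (s - a) a := by
    rw [ha, inner_sum]
    simp only [inner_smul_right]
  have hle : ∑ j, p j * ‖s + (v j - a)‖ ^ 2 ≤ ‖s‖ ^ 2 + M ^ 2 := by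
    calc ∑ j, p j * ‖s + (v j - a)‖ ^ 2
        ≤ ∑ j, (p j * (‖s‖ ^ 2 - 2 * inner ℝ s a + M ^ 2 + ‖a‖ ^ 2)
            + 2 * (p j * inner ℝ (s - a) (v j))) := by
          refine Finset.sum_le_sum fun j _ => ?_
          rw [hexp]
          have h1 : ‖v j‖ ^ 2 ≤ M ^ 2 := pow_le_pow_left₀ (norm_nonneg _) (hv j) 2
          have := mul_le_mul_of_nonneg_left h1 (hp j)
          linarith
      _ = ‖s‖ ^ 2 + M ^ 2 - ‖a‖ ^ 2 := by
          rw [Finset.sum_add_distrib, ← Finset.sum_mul, ← Finset.mul_sum, hinner, hp1,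
            inner_sub_left, real_inner_self_eq_norm_sq]
          ring
      _ ≤ _ := by have := sq_nonneg ‖a‖; linarith
  obtain ⟨j, hj⟩ : ∃ j, 0 < p j := by
    by_contra! h
    have : ∑ j, p j ≤ 0 := Finset.sum_nonpos fun j _ => h j
    linarith
  have hlt : ∑ j, p j * (‖s‖ ^ 2 + M ^ 2) < ∑ j, p j * ‖s + (v j - a)‖ ^ 2 :=
    Finset.sum_lt_sum (fun i _ => mul_le_mul_of_nonneg_left (hcon i).le (hp i))
      ⟨j, Finset.mem_univ _, mul_lt_mul_of_pos_left (hcon j) hj⟩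
  rw [← Finset.sum_mul, hp1, one_mul] at hlt
  linarith

/-- Maurey's lemma, for sums. -/
theorem exists_norm_sum_sub_sq_le {v : J → F} {M : ℝ} (hv : ∀ j, ‖v j‖ ≤ M)
    {p : J → ℝ} (hp : ∀ j, 0 ≤ p j) (hp1 : ∑ j, p j = 1) (k : ℕ) :
    ∃ φ : Fin k → J, ‖∑ i, (v (φ i) - ∑ i, p i • v i)‖ ^ 2 ≤ k * M ^ 2 := by
  induction k with
  | zero => exact ⟨Fin.elim0, by simp⟩
  | succ k ih =>
    obtain ⟨φ, hφ⟩ := ih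
    obtain ⟨j, hj⟩ := exists_norm_add_sub_sq_le hv hp hp1
      (∑ i, (v (φ i) - ∑ i, p i • v i))
    refine ⟨Fin.snoc φ j, ?_⟩
    rw [Fin.sum_univ_castSucc]
    simp only [Fin.snoc_castSucc, Fin.snoc_last]
    push_cast
    linarith

/-- Maurey's lemma: a convex combination of vectors in the ball of radius `M` is within distance
`M / √k` of the average of `k` of these vectors, and within `M` of zero. -/
theorem exists_norm_average_sub_le {v : J → F} {M : ℝ} (hM : 0 ≤ M) (hv : ∀ j, ‖v j‖ ≤ M)
    {p : J → ℝ} (hp : ∀ j, 0 ≤ p j) (hp1 : ∑ j, p j = 1) (k : ℕ) :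
    ∃ φ : Fin k → J, ‖(k : ℝ)⁻¹ • ∑ i, v (φ i) - ∑ i, p i • v i‖ ≤ M / √(max k 1 : ℕ) := by
  obtain ⟨φ, hφ⟩ := exists_norm_sum_sub_sq_le hv hp hp1 k
  refine ⟨φ, ?_⟩
  rcases Nat.eq_zero_or_pos k with rfl | hk
  -- The empty average is `0`, already within `M`: one center suffices at coarse scales.
  · simp only [Nat.cast_zero, inv_zero, zero_smul, zero_sub, norm_neg, zero_le, max_eq_right,
      Nat.cast_one, Real.sqrt_one, div_one]
    calc ‖∑ i, p i • v i‖ ≤ ∑ i, p i * M := by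
          refine norm_sum_le_of_le _ fun i _ => ?_
          rw [norm_smul, Real.norm_of_nonneg (hp i)]
          exact mul_le_mul_of_nonneg_left (hv i) (hp i)
      _ = M := by rw [← Finset.sum_mul, hp1, one_mul]
  · have hk' : (0 : ℝ) < k := by exact_mod_cast hk
    have hsk : 0 < √(k : ℝ) := Real.sqrt_pos.2 hk'
    have hsq : √(k : ℝ) ^ 2 = k := Real.sq_sqrt hk'.le
    have hm : max k 1 = k := max_eq_left hk
    rw [hm]
    set a := ∑ i, p i • v i with ha
    have hdecomp : (k : ℝ)⁻¹ • ∑ i, v (φ i) - a = (k : ℝ)⁻¹ • ∑ i, (v (φ i) - a) := by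
      rw [Finset.sum_sub_distrib, smul_sub, Finset.sum_const, Finset.card_univ, Fintype.card_fin,
        ← Nat.cast_smul_eq_nsmul ℝ, smul_smul, inv_mul_cancel₀ hk'.ne', one_smul]
    have hle : ‖∑ i, (v (φ i) - a)‖ ≤ √k * M := by
      refine le_of_sq_le_sq ?_ (by positivity)
      rw [mul_pow, hsq]; exact hφ
    rw [hdecomp, norm_smul, norm_inv, Real.norm_of_nonneg hk'.le, inv_mul_le_iff₀ hk']
    calc _ ≤ √k * M := hle
      _ = k * (M / √k) := by
        rw [eq_comm, mul_div_assoc', div_eq_iff hsk.ne', mul_right_comm, ← sq, hsq]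

end Maurey

/-! ### Frobenius covers of the entrywise `ℓ₁` ball -/

section MatrixCover

variable {p q : ℕ}

/-- The Frobenius norm of a matrix. -/
noncomputable def frobNorm (A : Matrix (Fin p) (Fin q) ℝ) : ℝ := √(∑ i, ∑ j, A i j ^ 2)

theorem frobNorm_nonneg (A : Matrix (Fin p) (Fin q) ℝ) : 0 ≤ frobNorm A := Real.sqrt_nonneg _

theorem norm_mulVec_le_frobNorm_mul (A : Matrix (Fin p) (Fin q) ℝ)
    (x : EuclideanSpace ℝ (Fin q)) :
    ‖(WithLp.toLp 2 (A.mulVec (WithLp.ofLp x)) : EuclideanSpace ℝ (Fin p))‖ ≤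
      frobNorm A * ‖x‖ := by
  rw [EuclideanSpace.norm_eq, EuclideanSpace.norm_eq, frobNorm, ← Real.sqrt_mul (by positivity)]
  refine Real.sqrt_le_sqrt ?_
  rw [Finset.sum_mul]
  refine Finset.sum_le_sum fun i _ => ?_
  simp only [Real.norm_eq_abs, sq_abs, Matrix.mulVec, dotProduct]
  exact Finset.sum_mul_sq_le_sq_mul_sq _ _ _

theorem frobNorm_le_entrywiseL1 (A : Matrix (Fin p) (Fin q) ℝ) :
    frobNorm A ≤ entrywiseL1 A := by
  refine Real.sqrt_le_iff.2 ⟨by unfold entrywiseL1; positivity, ?_⟩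
  unfold entrywiseL1
  rw [← Fintype.sum_prod_type' (f := fun i j => A i j ^ 2),
    ← Fintype.sum_prod_type' (f := fun i j => |A i j|)]
  calc ∑ x : Fin p × Fin q, A x.1 x.2 ^ 2 = ∑ x : Fin p × Fin q, |A x.1 x.2| ^ 2 := by
        simp only [sq_abs]
    _ ≤ _ := Finset.sum_sq_le_sq_sum_of_nonneg fun _ _ => abs_nonneg _

/-- The vertices `0` and `± M E_{ij}` used to approximate the entrywise `ℓ₁` ball of radius `M`. -/
noncomputable def l1Vertex (M : ℝ) :
    Option ((Fin p × Fin q) × Bool) → Matrix (Fin p) (Fin q) ℝ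
  | none => 0
  | some (x, b) => Matrix.of fun i j => if (i, j) = x then (if b then M else -M) else 0

theorem entrywiseL1_l1Vertex_le {M : ℝ} (hM : 0 ≤ M) (a : Option ((Fin p × Fin q) × Bool)) :
    entrywiseL1 (l1Vertex M a) ≤ M := by
  unfold entrywiseL1
  rw [← Fintype.sum_prod_type' (f := fun i j => |l1Vertex M a i j|)]
  rcases a with _ | ⟨x, b⟩
  · simpa [l1Vertex] using hM
  · have : ∀ y : Fin p × Fin q, |l1Vertex M (some (x, b)) y.1 y.2| = if y = x then M else 0 := by
      intro y
      by_cases h : y = x <;> cases b <;> simp [l1Vertex, h, abs_of_nonneg hM]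
    simp [this]

theorem entrywiseL1_average_le {M : ℝ} (hM : 0 ≤ M) {k : ℕ}
    {v : Fin k → Matrix (Fin p) (Fin q) ℝ} (hv : ∀ i, entrywiseL1 (v i) ≤ M) :
    entrywiseL1 ((k : ℝ)⁻¹ • ∑ i, v i) ≤ M := by
  have h1 : entrywiseL1 ((k : ℝ)⁻¹ • ∑ i, v i) ≤ (k : ℝ)⁻¹ * ∑ i, entrywiseL1 (v i) := by
    have hk : ∀ i j, |((k : ℝ)⁻¹ • ∑ l, v l) i j| = (k : ℝ)⁻¹ * |∑ l, v l i j| := by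
      intro i j
      rw [Matrix.smul_apply, Matrix.sum_apply, smul_eq_mul, abs_mul, abs_inv, Nat.abs_cast]
    unfold entrywiseL1
    calc _ = (k : ℝ)⁻¹ * ∑ i, ∑ j, |∑ l, v l i j| := by simp only [hk, Finset.mul_sum]
      _ ≤ (k : ℝ)⁻¹ * ∑ i, ∑ j, ∑ l, |v l i j| := by
          gcongr; exact Finset.abs_sum_le_sum_abs _ _
      _ = (k : ℝ)⁻¹ * ∑ i, ∑ l, ∑ j, |v l i j| := by
          congr 1; exact Finset.sum_congr rfl fun i _ => Finset.sum_comm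
      _ = _ := by congr 1; exact Finset.sum_comm
  refine h1.trans ?_
  calc (k : ℝ)⁻¹ * ∑ i, entrywiseL1 (v i) ≤ (k : ℝ)⁻¹ * ∑ _i : Fin k, M := by
        gcongr; exact hv _
    _ ≤ M := by
        rw [Finset.sum_const, Finset.card_univ, Fintype.card_fin, nsmul_eq_mul, ← mul_assoc]
        exact mul_le_of_le_one_left hM (inv_mul_le_one_of_le₀ le_rfl (Nat.cast_nonneg k))

/-- The centers of the cover of the entrywise `ℓ₁` ball of radius `M`: averages of `k` vertices. -/
noncomputable def l1Center (M : ℝ) {k : ℕ} (φ : Fin k → Option ((Fin p × Fin q) × Bool)) :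
    Matrix (Fin p) (Fin q) ℝ :=
  (k : ℝ)⁻¹ • ∑ i, l1Vertex M (φ i)

theorem entrywiseL1_l1Center_le {M : ℝ} (hM : 0 ≤ M) {k : ℕ}
    (φ : Fin k → Option ((Fin p × Fin q) × Bool)) : entrywiseL1 (l1Center M φ) ≤ M :=
  entrywiseL1_average_le hM fun i => entrywiseL1_l1Vertex_le hM (φ i)

/-- A matrix as a vector of a Euclidean space, whose norm is the Frobenius norm. -/
noncomputable def matrixToEuclidean :
    Matrix (Fin p) (Fin q) ℝ →ₗ[ℝ] EuclideanSpace ℝ (Fin p × Fin q) where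
  toFun A := WithLp.toLp 2 fun x => A x.1 x.2
  map_add' _ _ := rfl
  map_smul' _ _ := rfl

theorem norm_matrixToEuclidean (A : Matrix (Fin p) (Fin q) ℝ) :
    ‖matrixToEuclidean A‖ = frobNorm A := by
  rw [EuclideanSpace.norm_eq, frobNorm, Fintype.sum_prod_type]
  simp only [Real.norm_eq_abs, sq_abs]
  rfl

/-- The coefficients of a matrix as a convex combination of the vertices of the `ℓ₁` ball. -/
noncomputable def l1Weight (M : ℝ) (A : Matrix (Fin p) (Fin q) ℝ) :
    Option ((Fin p × Fin q) × Bool) → ℝ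
  | none => 1 - entrywiseL1 A / M
  | some (x, true) => max (A x.1 x.2) 0 / M
  | some (x, false) => max (-A x.1 x.2) 0 / M

theorem l1Weight_nonneg {M : ℝ} (hM : 0 < M) {A : Matrix (Fin p) (Fin q) ℝ}
    (hA : entrywiseL1 A ≤ M) (a : Option ((Fin p × Fin q) × Bool)) : 0 ≤ l1Weight M A a := by
  rcases a with _ | ⟨x, _ | _⟩
  · exact sub_nonneg.2 ((div_le_one hM).2 hA)
  · exact div_nonneg (le_max_right _ _) hM.le
  · exact div_nonneg (le_max_right _ _) hM.le

/-- Positive and negative parts of the entries add up to `entrywiseL1 A / M`; the vertex `0` carries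
the slack. -/
theorem sum_l1Weight (M : ℝ) (A : Matrix (Fin p) (Fin q) ℝ) :
    ∑ a, l1Weight M A a = 1 := by
  rw [Fintype.sum_option, Fintype.sum_prod_type]
  simp only [Fintype.sum_bool, l1Weight, entrywiseL1]
  have h : ∀ x : Fin p × Fin q, max (A x.1 x.2) 0 / M + max (-A x.1 x.2) 0 / M =
      |A x.1 x.2| / M := by
    intro x
    rw [← add_div, max_zero_add_max_neg_zero_eq_abs_self]
  simp only [h]
  rw [← Finset.sum_div, Fintype.sum_prod_type]
  ring

theorem sum_l1Weight_smul_l1Vertex {M : ℝ} (hM : 0 < M) (A : Matrix (Fin p) (Fin q) ℝ) :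
    ∑ a, l1Weight M A a • l1Vertex M a = A := by
  ext i j
  rw [Matrix.sum_apply, Fintype.sum_option, Fintype.sum_prod_type]
  simp only [Fintype.sum_bool, l1Vertex, l1Weight, Matrix.smul_apply, Matrix.zero_apply,
    smul_eq_mul, mul_zero, zero_add]
  rw [Finset.sum_eq_single (i, j)]
  · have : max (A i j) 0 - max (-A i j) 0 = A i j := by
      rcases le_total 0 (A i j) with h | h
      · rw [max_eq_left h, max_eq_right (by linarith)]; ring
      · rw [max_eq_right h, max_eq_left (by linarith)]; ring
    simp only [Matrix.of_apply, if_true, Bool.false_eq_true, if_false]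
    field_simp
    linarith
  · intro x _ hx
    simp [Ne.symm hx]
  · simp

/-- The averages of `k` vertices cover the entrywise `ℓ₁` ball in the Frobenius norm. -/
theorem exists_frobNorm_sub_l1Center_le {M : ℝ} (hM : 0 < M) {A : Matrix (Fin p) (Fin q) ℝ}
    (hA : entrywiseL1 A ≤ M) (k : ℕ) :
    ∃ φ : Fin k → Option ((Fin p × Fin q) × Bool),
      frobNorm (A - l1Center M φ) ≤ M / √(max k 1 : ℕ) := by
  obtain ⟨φ, hφ⟩ := exists_norm_average_sub_le (v := fun a => matrixToEuclidean (l1Vertex M a))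
    hM.le (fun a => by
      rw [norm_matrixToEuclidean]
      exact (frobNorm_le_entrywiseL1 _).trans (entrywiseL1_l1Vertex_le hM.le a))
    (l1Weight_nonneg hM hA) (sum_l1Weight M A) k
  refine ⟨φ, ?_⟩
  simp only [← map_sum, ← map_smul, ← map_sub] at hφ
  rw [sum_l1Weight_smul_l1Vertex hM, ← norm_neg, ← map_neg, neg_sub, norm_matrixToEuclidean] at hφ
  exact hφ

end MatrixCover

/-! ### Projections, reconstruction errors and networks -/

section Reconstruction

/-- Add the variational inequalities of the two projections, each tested at the other, and apply
Cauchy–Schwarz. -/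
theorem norm_projOnto_sub_le {E : Type*} [NormedAddCommGroup E] [InnerProductSpace ℝ E]
    {S : Set E} (hS : IsCompact S) (hne : S.Nonempty) (hc : Convex ℝ S) (x y : E) :
    ‖projOnto S x - projOnto S y‖ ≤ ‖x - y‖ := by
  have hvar : ∀ x, ∀ v ∈ S, inner ℝ (x - projOnto S x) (v - projOnto S x) ≤ 0 := by
    intro x
    obtain ⟨hmem, hmin⟩ := projOnto_spec hS hne x
    refine (norm_eq_iInf_iff_real_inner_le_zero hc hmem).1 (le_antisymm ?_ ?_)
    · have : Nonempty S := hne.to_subtype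
      exact le_ciInf fun v => hmin v v.2
    · exact ciInf_le (f := fun v : S => ‖x - v‖)
        ⟨0, Set.forall_mem_range.2 fun _ => norm_nonneg _⟩ ⟨_, hmem⟩
  have h1 := hvar x _ (projOnto_spec hS hne y).1
  have h2 := hvar y _ (projOnto_spec hS hne x).1
  set u := projOnto S x
  set v := projOnto S y
  have h3 : ‖u - v‖ ^ 2 ≤ inner ℝ (x - y) (u - v) := by
    have e : inner ℝ (x - y) (u - v) - ‖u - v‖ ^ 2 =
        -(inner ℝ (x - u) (v - u)) - inner ℝ (y - v) (u - v) := by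
      rw [← real_inner_self_eq_norm_sq, ← inner_sub_left, ← inner_neg_right, neg_sub,
        ← inner_sub_left]
      congr 1
      abel
    linarith
  have h4 := real_inner_le_norm (x - y) (u - v)
  by_contra! hlt
  have h5 : 0 < ‖u - v‖ := (norm_nonneg _).trans_lt hlt
  nlinarith

variable {X E : Type*} [NormedAddCommGroup E]

theorem bddBelow_range_norm_sub_sq (H : Set X) (f : X → E) (z : E) :
    BddBelow (Set.range fun h : H => ‖z - f h‖ ^ 2) :=
  ⟨0, Set.forall_mem_range.2 fun _ => sq_nonneg _⟩

/-- An infimum of continuous functions is upper semicontinuous, even over an uncountable `H` and for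
arbitrary `f`. -/
theorem measurable_minError [MeasurableSpace E] [OpensMeasurableSpace E] (H : Set X) (f : X → E) :
    Measurable (minError H f) :=
  (upperSemicontinuous_ciInf (f := fun (h : H) (z : E) => ‖z - f h‖ ^ 2)
    (bddBelow_range_norm_sub_sq H f)
    fun _ => Continuous.upperSemicontinuous (by fun_prop)).measurable

theorem minError_mem_Icc {H : Set X} (hH : H.Nonempty) {S : Set E} (hS : Bornology.IsBounded S)
    {f : X → E} (hf : ∀ h ∈ H, f h ∈ S) {z : E} (hz : z ∈ S) :
    minError H f z ∈ Set.Icc 0 (Metric.diam S ^ 2) := by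
  obtain ⟨h, hh⟩ := hH
  refine ⟨Real.iInf_nonneg fun _ => sq_nonneg _,
    (ciInf_le (bddBelow_range_norm_sub_sq H f z) ⟨h, hh⟩).trans ?_⟩
  have := Metric.dist_le_diam_of_mem hS hz (hf h hh)
  rw [dist_eq_norm] at this
  exact pow_le_pow_left₀ (norm_nonneg _) this 2

/-- Factor `a ^ 2 - b ^ 2 = (a - b) * (a + b)` for each codeword, with both distances at most the
diameter. -/
theorem minError_le_add {H : Set X} (hH : H.Nonempty) {S : Set E} (hS : Bornology.IsBounded S)
    {f g : X → E} (hf : ∀ h ∈ H, f h ∈ S) (hg : ∀ h ∈ H, g h ∈ S) {c : ℝ}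
    (hfg : ∀ h ∈ H, ‖f h - g h‖ ≤ c) {z : E} (hz : z ∈ S) :
    minError H f z ≤ minError H g z + 2 * Metric.diam S * c := by
  have : Nonempty H := hH.to_subtype
  rw [← sub_le_iff_le_add]
  refine le_ciInf fun h => ?_
  rw [sub_le_iff_le_add]
  refine (ciInf_le (bddBelow_range_norm_sub_sq H f z) h).trans ?_
  have h1 := Metric.dist_le_diam_of_mem hS hz (hf h h.2)
  have h2 := Metric.dist_le_diam_of_mem hS hz (hg h h.2)
  rw [dist_eq_norm] at h1 h2
  have h3 : ‖z - f h‖ - ‖z - g h‖ ≤ c := by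
    refine (norm_sub_norm_le _ _).trans ?_
    rw [sub_sub_sub_cancel_left, norm_sub_rev]
    exact hfg h h.2
  have h4 : 0 ≤ c := (norm_nonneg _).trans (hfg h h.2)
  have h5 : (‖z - f h‖ - ‖z - g h‖) * (‖z - f h‖ + ‖z - g h‖) ≤
      c * (‖z - f h‖ + ‖z - g h‖) := mul_le_mul_of_nonneg_right h3 (by positivity)
  have h6 : c * (‖z - f h‖ + ‖z - g h‖) ≤ c * (2 * Metric.diam S) :=
    mul_le_mul_of_nonneg_left (by linarith) h4
  linarith

theorem abs_minError_sub_le {H : Set X} (hH : H.Nonempty) {S : Set E}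
    (hS : Bornology.IsBounded S)
    {f g : X → E} (hf : ∀ h ∈ H, f h ∈ S) (hg : ∀ h ∈ H, g h ∈ S) {c : ℝ}
    (hfg : ∀ h ∈ H, ‖f h - g h‖ ≤ c) {z : E} (hz : z ∈ S) :
    |minError H f z - minError H g z| ≤ 2 * Metric.diam S * c := by
  have h1 := minError_le_add hH hS hf hg hfg hz
  have h2 := minError_le_add hH hS hg hf (fun h hh => norm_sub_rev (f h) (g h) ▸ hfg h hh) hz
  rw [abs_le]
  constructor <;> linarith

theorem reconRisk_sub_reconRisk_empiricalMeasure [MeasurableSpace E]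
    [MeasurableSingletonClass E] {n : ℕ} (H : Set X) (P : Measure E) (f : X → E) (z : Fin n → E) :
    reconRisk H P f - reconRisk H (empiricalMeasure z) f =
      meanDeviation P z (minError H f) := by
  rw [reconRisk, reconRisk, meanDeviation, empiricalMeasure, integral_smul_measure,
    integral_finsetSum_measure fun _ _ => integrable_dirac (by simp)]
  simp

theorem norm_le_supNorm {H : Set E} (hH : IsCompact H) {h : E} (hh : h ∈ H) :
    ‖h‖ ≤ supNorm H :=
  le_csSup (hH.image continuous_norm).bddAbove ⟨h, hh, rfl⟩

end Reconstruction

/-! ### Perturbation of the weights and covers of the network class -/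

section Networks

variable {ℓ : ℕ} {w : ℕ → ℕ}
  {σ : ∀ j, EuclideanSpace ℝ (Fin (w (j + 1))) → EuclideanSpace ℝ (Fin (w (j + 1)))}
  {L : ℕ → ℝ≥0} {B M : ℕ → ℝ} {H : Set (EuclideanSpace ℝ (Fin (w 0)))}

theorem norm_denseNet_le_inputBound (hB : ∀ j < ℓ, ∀ x, ‖σ j x‖ ≤ B j) (hH : IsCompact H)
    (A : ∀ j, Matrix (Fin (w (j + 1))) (Fin (w j)) ℝ)
    {h : EuclideanSpace ℝ (Fin (w 0))} (hh : h ∈ H) {m : ℕ} (hm : m ≤ ℓ) :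
    ‖denseNet w σ A m h‖ ≤ inputBound H B m := by
  cases m with
  | zero => exact norm_le_supNorm hH hh
  | succ m => exact hB m hm _

/-- Networks depend on their weights in a Lipschitz way, uniformly over the inputs in `H`. -/
theorem norm_denseNet_sub_le (hL : ∀ j < ℓ, LipschitzWith (L j) (σ j))
    (hB : ∀ j < ℓ, ∀ x, ‖σ j x‖ ≤ B j) (hH : IsCompact H)
    {A A' : ∀ j, Matrix (Fin (w (j + 1))) (Fin (w j)) ℝ}
    (hA : ∀ j < ℓ, frobNorm (A j) ≤ M j) {η : ℝ}
    (hAA' : ∀ j < ℓ, frobNorm (A j - A' j) ≤ M j * η)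
    {h : EuclideanSpace ℝ (Fin (w 0))} (hh : h ∈ H) {m : ℕ} (hm : m ≤ ℓ) :
    ‖denseNet w σ A m h - denseNet w σ A' m h‖ ≤
      η * ∑ i ∈ Finset.range m, inputBound H B i * ∏ j ∈ Finset.Ico i m, (L j : ℝ) * M j := by
  induction m with
  | zero => simp [denseNet]
  | succ m ih =>
    have hm' : m < ℓ := hm
    have ih := ih hm'.le
    have hx := norm_denseNet_le_inputBound hB hH A' hh hm'.le
    have hfrob := (frobNorm_nonneg (A m - A' m)).trans (hAA' m hm')
    have hM0 : 0 ≤ M m := (frobNorm_nonneg _).trans (hA m hm')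
    simp only [denseNet, denseLayer]
    set x := denseNet w σ A m h
    set x' := denseNet w σ A' m h
    -- The inherited error passes through `A m`; the new error `A m - A' m` meets an input bounded
    -- by `inputBound`, whatever the earlier weights are.
    have hsplit : (WithLp.toLp 2 ((A m).mulVec (WithLp.ofLp x)) :
          EuclideanSpace ℝ (Fin (w (m + 1)))) - WithLp.toLp 2 ((A' m).mulVec (WithLp.ofLp x')) =
        WithLp.toLp 2 ((A m).mulVec (WithLp.ofLp (x - x'))) +
          WithLp.toLp 2 ((A m - A' m).mulVec (WithLp.ofLp x')) := by
      rw [WithLp.ofLp_sub, Matrix.mulVec_sub, Matrix.sub_mulVec, WithLp.toLp_sub, WithLp.toLp_sub]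
      abel
    have hlip := (hL m hm').dist_le_mul (WithLp.toLp 2 ((A m).mulVec (WithLp.ofLp x)))
      (WithLp.toLp 2 ((A' m).mulVec (WithLp.ofLp x')))
    rw [dist_eq_norm, dist_eq_norm, hsplit] at hlip
    set s := ∑ i ∈ Finset.range m, inputBound H B i * ∏ j ∈ Finset.Ico i m, (L j : ℝ) * M j
      with hs
    have hsum : ∑ i ∈ Finset.range (m + 1), inputBound H B i *
        ∏ j ∈ Finset.Ico i (m + 1), (L j : ℝ) * M j =
        s * (L m * M m) + inputBound H B m * (L m * M m) := by
      rw [Finset.sum_range_succ, hs, Finset.sum_mul]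
      congr 1
      · refine Finset.sum_congr rfl fun i hi => ?_
        rw [Finset.prod_Ico_succ_top (Finset.mem_range.1 hi).le, mul_assoc]
      · simp
    rw [hsum]
    refine hlip.trans ?_
    calc (L m : ℝ) * _ ≤ L m * (M m * (η * s) + M m * η * inputBound H B m) := by
          refine mul_le_mul_of_nonneg_left ((norm_add_le _ _).trans (add_le_add ?_ ?_))
            (L m).coe_nonneg
          · exact (norm_mulVec_le_frobNorm_mul _ _).trans
              (mul_le_mul (hA m hm') ih (norm_nonneg _) hM0)
          · exact (norm_mulVec_le_frobNorm_mul _ _).trans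
              (mul_le_mul (hAA' m hm') hx (norm_nonneg _) hfrob)
      _ = _ := by ring

/-- The product of the covers of the `ℓ₁` balls of the layers. -/
theorem exists_finset_l1Cover (ℓ : ℕ) (w : ℕ → ℕ) (hM : ∀ j < ℓ, 0 < M j) (k : ℕ) :
    ∃ C : Finset (∀ j, Matrix (Fin (w (j + 1))) (Fin (w j)) ℝ),
      (C.card : ℝ) ≤
        Real.exp (k * ∑ i ∈ Finset.range ℓ, Real.log (2 * w i * w (i + 1) + 1)) ∧
      (∀ A ∈ C, ∀ j < ℓ, entrywiseL1 (A j) ≤ M j) ∧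
      ∀ A : ∀ j, Matrix (Fin (w (j + 1))) (Fin (w j)) ℝ, (∀ j < ℓ, entrywiseL1 (A j) ≤ M j) →
        ∃ A' ∈ C, ∀ j < ℓ, frobNorm (A j - A' j) ≤ M j * (1 / √(max k 1 : ℕ)) := by
  classical
  let c : (∀ j : Fin ℓ, Fin k → Option ((Fin (w (j + 1)) × Fin (w j)) × Bool)) →
      ∀ j, Matrix (Fin (w (j + 1))) (Fin (w j)) ℝ :=
    fun φ j => if hj : j < ℓ then l1Center (M j) (φ ⟨j, hj⟩) else 0
  refine ⟨Finset.univ.image c, ?_, ?_, ?_⟩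
  · have hcard : ((Finset.univ.image c).card : ℝ) ≤
        ∏ j : Fin ℓ, ((2 * w j * w (j + 1) + 1 : ℝ)) ^ k := by
      refine (Nat.cast_le.2 Finset.card_image_le).trans (le_of_eq ?_)
      rw [Finset.card_univ, Fintype.card_pi]
      push_cast
      refine Finset.prod_congr rfl fun j _ => ?_
      simp only [Fintype.card_pi, Fintype.card_option, Fintype.card_prod, Fintype.card_fin,
        Fintype.card_bool, Finset.prod_const, Finset.card_univ]
      push_cast
      ring
    refine hcard.trans (le_of_eq ?_)
    rw [← Fin.sum_univ_eq_sum_range (fun i => Real.log (2 * w i * w (i + 1) + 1)), Finset.mul_sum,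
      Real.exp_sum]
    refine Finset.prod_congr rfl fun j _ => ?_
    rw [Real.exp_nat_mul, Real.exp_log (by positivity)]
  · intro A hA j hj
    obtain ⟨φ, -, rfl⟩ := Finset.mem_image.1 hA
    simp only [c, dif_pos hj]
    exact entrywiseL1_l1Center_le (hM j hj).le _
  · intro A hA
    choose! φ hφ using fun (j : Fin ℓ) => exists_frobNorm_sub_l1Center_le (hM j j.2) (hA j j.2) k
    refine ⟨c φ, Finset.mem_image_of_mem _ (Finset.mem_univ _), fun j hj => ?_⟩
    simp only [c, dif_pos hj]
    rw [mul_one_div]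
    exact hφ ⟨j, hj⟩

/-- The reconstruction errors of the projected networks with weights in the `ℓ₁` balls. -/
def denseErrorClass (w : ℕ → ℕ)
    (σ : ∀ j, EuclideanSpace ℝ (Fin (w (j + 1))) → EuclideanSpace ℝ (Fin (w (j + 1))))
    (M : ℕ → ℝ) (ℓ : ℕ) (H : Set (EuclideanSpace ℝ (Fin (w 0))))
    (S : Set (EuclideanSpace ℝ (Fin (w ℓ)))) : Set (EuclideanSpace ℝ (Fin (w ℓ)) → ℝ) :=
  {g | ∃ A : ∀ j, Matrix (Fin (w (j + 1))) (Fin (w j)) ℝ,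
    (∀ j < ℓ, entrywiseL1 (A j) ≤ M j) ∧
      g = minError H fun h => projOnto S (denseNet w σ A ℓ h)}

theorem inputBound_nonneg (hB : ∀ j < ℓ, ∀ x, ‖σ j x‖ ≤ B j) (hH : IsCompact H)
    (hH₀ : H.Nonempty) {m : ℕ} (hm : m ≤ ℓ) : 0 ≤ inputBound H B m := by
  obtain ⟨h, hh⟩ := hH₀
  exact (norm_nonneg _).trans (norm_denseNet_le_inputBound hB hH 0 hh hm)

theorem exists_finset_denseErrorClass_cover (hL : ∀ j < ℓ, LipschitzWith (L j) (σ j))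
    (hB : ∀ j < ℓ, ∀ x, ‖σ j x‖ ≤ B j) (hM : ∀ j < ℓ, 0 < M j)
    (hH : IsCompact H) (hH₀ : H.Nonempty)
    {S : Set (EuclideanSpace ℝ (Fin (w ℓ)))} (hS : IsCompact S) (hS₀ : S.Nonempty)
    (hSc : Convex ℝ S) {ε : ℝ} (hε : 0 < ε) :
    ∃ C : Finset (EuclideanSpace ℝ (Fin (w ℓ)) → ℝ), ↑C ⊆ denseErrorClass w σ M ℓ H S ∧
      (C.card : ℝ) ≤ Real.exp ((2 * √2 * Metric.diam S *
        (∑ i ∈ Finset.range ℓ, inputBound H B i * ∏ j ∈ Finset.Ico i ℓ, (L j : ℝ) * M j) *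
        √(∑ i ∈ Finset.range ℓ, Real.log (2 * w i * w (i + 1) + 1))) ^ 2 / ε ^ 2) ∧
      ∀ g ∈ denseErrorClass w σ M ℓ H S, ∃ c ∈ C, ∀ x ∈ S, |g x - c x| ≤ ε := by
  classical
  set Λ := ∑ i ∈ Finset.range ℓ, inputBound H B i * ∏ j ∈ Finset.Ico i ℓ, (L j : ℝ) * M j
    with hΛ
  set s := ∑ i ∈ Finset.range ℓ, Real.log (2 * w i * w (i + 1) + 1) with hs
  set D := Metric.diam S with hD
  have hs0 : 0 ≤ s := Finset.sum_nonneg fun i _ => Real.log_nonneg (by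
    have : (0 : ℝ) ≤ 2 * w i * w (i + 1) := by positivity
    linarith)
  -- Rounding down keeps the entropy below `y * s`, which is exactly `V ^ 2 / ε ^ 2`. The factor `2`
  -- compensates for it, as `y ≤ ⌊y⌋₊ + 1 ≤ 2 * max ⌊y⌋₊ 1`.
  set y : ℝ := 2 * (2 * D * Λ) ^ 2 / ε ^ 2 with hy
  have hy0 : 0 ≤ y := by positivity
  obtain ⟨C, hcard, hCM, hC⟩ := exists_finset_l1Cover ℓ w hM ⌊y⌋₊
  refine ⟨C.image fun A => minError H fun h => projOnto S (denseNet w σ A ℓ h), ?_, ?_, ?_⟩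
  · intro g hg
    obtain ⟨A, hA, rfl⟩ := Finset.mem_image.1 (Finset.mem_coe.1 hg)
    exact ⟨A, hCM A hA, rfl⟩
  · refine (Nat.cast_le.2 Finset.card_image_le).trans (hcard.trans (Real.exp_le_exp.2 ?_))
    calc (⌊y⌋₊ : ℝ) * s ≤ y * s := mul_le_mul_of_nonneg_right (Nat.floor_le hy0) hs0
      _ = _ := by
        simp only [mul_pow, Real.sq_sqrt hs0, Real.sq_sqrt (zero_le_two : (0 : ℝ) ≤ 2), hy]
        ring
  · rintro g ⟨A, hA, rfl⟩
    obtain ⟨A', hA', hAA'⟩ := hC A hA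
    refine ⟨_, Finset.mem_image_of_mem _ hA', fun x hx => ?_⟩
    set m : ℝ := ((max ⌊y⌋₊ 1 : ℕ) : ℝ) with hm
    have hym : y ≤ 2 * m := by
      have h1 := (Nat.lt_floor_add_one y).le
      have h2 : (⌊y⌋₊ : ℝ) ≤ m := Nat.cast_le.2 (le_max_left _ _)
      have h3 : (1 : ℝ) ≤ m := by rw [hm]; exact_mod_cast le_max_right _ _
      linarith
    have hm0 : 0 < m := by rw [hm]; exact_mod_cast lt_max_of_lt_right one_pos
    have hmem : ∀ v, projOnto S v ∈ S := fun v => (projOnto_spec hS hS₀ v).1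
    refine (abs_minError_sub_le hH₀ hS.isBounded (fun _ _ => hmem _) (fun _ _ => hmem _)
      (fun h hh => (norm_projOnto_sub_le hS hS₀ hSc _ _).trans
        (norm_denseNet_sub_le hL hB hH
          (fun j hj => (frobNorm_le_entrywiseL1 _).trans (hA j hj)) hAA' hh le_rfl)) hx).trans ?_
    have hle : 2 * D * Λ ≤ ε * √m := by
      refine le_of_sq_le_sq ?_ (by positivity)
      rw [mul_pow ε, Real.sq_sqrt hm0.le]
      rw [hy, div_le_iff₀ (by positivity)] at hym
      linarith
    calc 2 * D * (1 / √m * Λ) = 2 * D * Λ / √m := by ring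
      _ ≤ ε := (div_le_iff₀ (Real.sqrt_pos.2 hm0)).2 hle

end Networks

theorem mainTheorem6
    {Ω : Type*} [MeasurableSpace Ω] (μ : Measure Ω) [IsProbabilityMeasure μ]
    -- depth, widths, activations and their constants
    (ℓ : ℕ) (w : ℕ → ℕ)
    (σ : ∀ j, EuclideanSpace ℝ (Fin (w (j + 1))) → EuclideanSpace ℝ (Fin (w (j + 1))))
    (L : ℕ → ℝ≥0) (B M : ℕ → ℝ)
    (hL : ∀ j < ℓ, LipschitzWith (L j) (σ j))
    (hB : ∀ j < ℓ, ∀ x, ‖σ j x‖ ≤ B j)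
    -- parameter sets
    (𝒜 : ∀ j, Set (Matrix (Fin (w (j + 1))) (Fin (w j)) ℝ))
    (hM : ∀ j < ℓ, 0 < M j)
    (h𝒜 : ∀ j < ℓ, ∀ A ∈ 𝒜 j, entrywiseL1 A ≤ M j)
    -- codebook and data space
    (H : Set (EuclideanSpace ℝ (Fin (w 0)))) (hH : IsCompact H) (hH₀ : H.Nonempty)
    (𝒵 : Set (EuclideanSpace ℝ (Fin (w ℓ)))) (h𝒵 : IsCompact 𝒵) (h𝒵c : Convex ℝ 𝒵)
    -- data-generating distribution and i.i.d. sample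
    (P : Measure (EuclideanSpace ℝ (Fin (w ℓ)))) [IsProbabilityMeasure P]
    (hP : ∀ᵐ z ∂P, z ∈ 𝒵)
    (n : ℕ) (hn : 0 < n)
    (Z : Fin n → Ω → EuclideanSpace ℝ (Fin (w ℓ)))
    (hZ : ∀ i, Measurable (Z i)) (hindep : iIndepFun Z μ) (hlaw : ∀ i, μ.map (Z i) = P)
    (δ : ℝ) (hδ₀ : 0 < δ) (hδ₁ : δ < 1) :
    -- the bound fails with probability at most `δ`
    μ {ω | genError H P (denseClass w σ 𝒜 ℓ 𝒵) (fun i => Z i ω) ≤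
      ENNReal.ofReal
        (48 * √2 * Real.log n / √n * Metric.diam 𝒵
            * (∑ i ∈ Finset.range ℓ, inputBound H B i * ∏ j ∈ Finset.Ico i ℓ, (L j : ℝ) * M j)
            * √(∑ i ∈ Finset.range ℓ, Real.log (2 * w i * w (i + 1) + 1))
          + 8 * Metric.diam 𝒵 ^ 2 / √n
          + Metric.diam 𝒵 ^ 2 * √(2 * Real.log (2 / δ) / n))}ᶜ
      ≤ ENNReal.ofReal δ := by
  have hS₀ : 𝒵.Nonempty := by
    obtain ⟨z, hz⟩ := hP.exists
    exact ⟨z, hz⟩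
  set Λ := ∑ i ∈ Finset.range ℓ, inputBound H B i * ∏ j ∈ Finset.Ico i ℓ, (L j : ℝ) * M j
    with hΛ
  set s := ∑ i ∈ Finset.range ℓ, Real.log (2 * w i * w (i + 1) + 1) with hs
  have hΛ0 : 0 ≤ Λ := Finset.sum_nonneg fun i hi =>
    mul_nonneg (inputBound_nonneg hB hH hH₀ (Finset.mem_range.1 hi).le)
      (Finset.prod_nonneg fun j hj =>
        mul_nonneg (L j).coe_nonneg (hM j (Finset.mem_Ico.1 hj).2).le)
  have hmem : ∀ v, projOnto 𝒵 v ∈ 𝒵 := fun v => (projOnto_spec h𝒵 hS₀ v).1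
  -- The class is enlarged from `𝒜 j` to full `ℓ₁` balls: Maurey's centers need not lie in `𝒜 j`,
  -- while chaining needs centers inside the class.
  have hmain := measure_compl_uniform_meanDeviation_le hP hn hZ hindep hlaw
    (G := denseErrorClass w σ M ℓ H 𝒵) (K := Metric.diam 𝒵 ^ 2)
    (V := 2 * √2 * Metric.diam 𝒵 * Λ * √s)
    (by rintro g ⟨A, -, rfl⟩; exact measurable_minError H _) (sq_nonneg _) (by positivity)
    (by
      rintro g ⟨A, -, rfl⟩ x hx
      exact minError_mem_Icc hH₀ h𝒵.isBounded (fun _ _ => hmem _) hx)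
    (fun ε hε => exists_finset_denseErrorClass_cover hL hB hM hH hH₀ h𝒵 hS₀ h𝒵c hε) hδ₀ hδ₁
  refine (measure_mono (Set.compl_subset_compl.2 fun ω hω => ?_)).trans hmain
  rw [Set.mem_ofPred_eq, genError]
  refine iSup₂_le fun f hf => ?_
  obtain ⟨A, hA, rfl⟩ := hf
  rw [reconRisk_sub_reconRisk_empiricalMeasure]
  refine ENNReal.ofReal_le_ofReal ((hω _ ⟨A, fun j hj => h𝒜 j hj _ (hA j hj), rfl⟩).trans
    (le_of_eq ?_))
  ring
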